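/- **Theorem (Correctness of bidirectional typing for CC$_\omega$).** Terms, up to renaming of bound variables, are $t ::= x \mid \square_i \mid \Pi x : t.\,t \mid \lambda x : t.\,t \mid t\;t$, where $x$ is a variable and $i \in \mathbb{N}$. Reduction $\to$ is the least relation that is closed under all term constructors and satisfies $(\lambda x : T.\,t)\,u \to t[u/x]$; $\to^*$ is its reflexive transitive closure, and conversion $\cong$ is its reflexive, symmetric, transitive closure. Contexts $\Gamma$ are finite lists of declarations $x : A$ of distinct variables. *Undirected typing.* The judgements $\vdash \Gamma$ and $\Gamma \vdash t : T$ are defined by mutual induction by the rules: - $\vdash \cdot$; if $\vdash \Gamma$ and $\Gamma \vdash A : \square_i$ then $\vdash \Gamma, x : A$; - if $\vdash \Gamma$ then $\Gamma \vdash \square_i : \square_{i+1}$; if $\vdash \Gamma$ and $(x : A) \in \Gamma$ then $\Gamma \vdash x : A$; - if $\Gamma \vdash A : \square_i$ and $\Gamma, x : A \vdash B : \square_j$ then $\Gamma \vdash \Pi x : A.\,B : \square_{\max(i,j)}$; - if $\Gamma \vdash \Pi x : A.\,B : \square_i$ and $\Gamma, x : A \vdash t : B$ then $\Gamma \vdash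 \lambda x : A.\,t : \Pi x : A.\,B$; - if $\Gamma \vdash t : \Pi x : A.\,B$ and $\Gamma \vdash u : A$ then $\Gamma \vdash t\,u : B[u/x]$; - if $\Gamma \vdash t : A$, $\Gamma \vdash B : \square_i$ and $A \cong B$ then $\Gamma \vdash t : B$. *Bidirectional typing.* The judgements of inference $\Gamma \vdash t \triangleright T$, checking $\Gamma \vdash t \triangleleft T$ and constrained inference $\Gamma \vdash t \triangleright_h T$ with $h \in \{\square, \Pi\}$ are defined by mutual induction by the rules: - $\Gamma \vdash \square_i \triangleright \square_{i+1}$; if $(x : T) \in \Gamma$ then $\Gamma \vdash x \triangleright T$; - if $\Gamma \vdash A \triangleright_\square \square_i$ and $\Gamma, x : A \vdash B \triangleright_\square \square_j$ then $\Gamma \vdash \Pi x : A.\,B \triangleright \square_{\max(i,j)}$; - if $\Gamma \vdash A \triangleright_\square \square_i$ and $\Gamma, x : A \vdash t \triangleright B$ then $\Gamma \vdash \lambda x : A.\,t \triangleright \Pi x : A.\,B$; - if $\Gamma \vdash t \triangleright_\Pi \Pi x : A.\,B$ and $\Gamma \vdash u \triangleleft A$ then $\Gamma \vdash t\,u \triangleright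 B[u/x]$; - if $\Gamma \vdash t \triangleright T'$ and $T' \cong T$ then $\Gamma \vdash t \triangleleft T$; - if $\Gamma \vdash t \triangleright T$ and $T \to^* \square_i$ then $\Gamma \vdash t \triangleright_\square \square_i$; - if $\Gamma \vdash t \triangleright T$ and $T \to^* \Pi x : A.\,B$ then $\Gamma \vdash t \triangleright_\Pi \Pi x : A.\,B$. A context $\Gamma$ is *well-formed* if $\vdash \Gamma$, and a type $T$ is *well-formed* in $\Gamma$ if $\Gamma \vdash T : \square_i$ for some $i$. Then, for all $\Gamma$, $t$, $T$: 1. if $\Gamma$ is well-formed and either $\Gamma \vdash t \triangleright T$ or $\Gamma \vdash t \triangleright_h T$ for some $h$, then $\Gamma \vdash t : T$; 2. if $\Gamma$ is well-formed, $T$ is well-formed in $\Gamma$ and $\Gamma \vdash t \triangleleft T$, then $\Gamma \vdash t : T$. -/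

import Mathlib

namespace CComega

/-- Terms of CCω, up to renaming of bound variables: a variable is a de Bruijn index,
`sort i` is the universe `□ i` of level `i = 0, 1, 2, …`, `prod A B` is `Π x : A. B`,
`lam A t` is `λ x : A. t` (the second argument of `prod` and of `lam` lives under one more
binder, whose variable is `var 0`), and `app t u` is the application `t u`. -/
inductive Term : Type
  | var (n : ℕ) : Term
  | sort (i : ℕ) : Term
  | prod (A B : Term) : Term
  | lam (A t : Term) : Term
  | app (t u : Term) : Term

/-- Extension of a renaming under a binder. -/
def upRen (ρ : ℕ → ℕ) : ℕ → ℕ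
  | 0 => 0
  | n + 1 => ρ n + 1

/-- Renaming of the free variables of a term. -/
def Term.rename : (ℕ → ℕ) → Term → Term
  | ρ, .var n => .var (ρ n)
  | _, .sort i => .sort i
  | ρ, .prod A B => .prod (A.rename ρ) (B.rename (upRen ρ))
  | ρ, .lam A t => .lam (A.rename ρ) (t.rename (upRen ρ))
  | ρ, .app t u => .app (t.rename ρ) (u.rename ρ)

/-- The same term, viewed in a context with one more variable. -/
def Term.shift (t : Term) : Term := t.rename Nat.succ

/-- Extension of a simultaneous substitution under a binder. -/
def upSubst (σ : ℕ → Term) : ℕ → Term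
  | 0 => .var 0
  | n + 1 => (σ n).shift

/-- Simultaneous capture-avoiding substitution of the free variables of a term. -/
def Term.subst : (ℕ → Term) → Term → Term
  | σ, .var n => σ n
  | _, .sort i => .sort i
  | σ, .prod A B => .prod (A.subst σ) (B.subst (upSubst σ))
  | σ, .lam A t => .lam (A.subst σ) (t.subst (upSubst σ))
  | σ, .app t u => .app (t.subst σ) (u.subst σ)

/-- The substitution that sends the last declared variable to `u` and fixes the others. -/
def single (u : Term) : ℕ → Term
  | 0 => u
  | n + 1 => .var n

/-- `t.inst u` is `t[u/x]`, where `x` is the last declared variable. -/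
def Term.inst (t u : Term) : Term := t.subst (single u)

/-- One-step reduction: the closure of β under all term constructors. -/
inductive Red : Term → Term → Prop
  | beta (T t u : Term) : Red (.app (.lam T t) u) (t.inst u)
  | prod_left {A A' : Term} (B : Term) : Red A A' → Red (.prod A B) (.prod A' B)
  | prod_right (A : Term) {B B' : Term} : Red B B' → Red (.prod A B) (.prod A B')
  | lam_left {A A' : Term} (t : Term) : Red A A' → Red (.lam A t) (.lam A' t)
  | lam_right (A : Term) {t t' : Term} : Red t t' → Red (.lam A t) (.lam A t')
  | app_left {t t' : Term} (u : Term) : Red t t' → Red (.app t u) (.app t' u)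
  | app_right (t : Term) {u u' : Term} : Red u u' → Red (.app t u) (.app t u')

/-- The reflexive, transitive closure of reduction. -/
def Reds : Term → Term → Prop := Relation.ReflTransGen Red

/-- Conversion: the symmetric, reflexive, transitive closure of reduction. -/
def Conv : Term → Term → Prop := Relation.EqvGen Red

/-- A context is the list of the declared types, the last declaration first (`A :: Γ` is
`Γ, x : A`); each type lives in the context formed by the earlier declarations. -/
abbrev Ctx : Type := List Term

/-- `InCtx Γ n A` is `(x : A) ∈ Γ` for the variable `x` of index `n`; the declared type is
shifted so as to live in the whole of `Γ`. -/
inductive InCtx : Ctx → ℕ → Term → Prop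
  | here (Γ : Ctx) (A : Term) : InCtx (A :: Γ) 0 A.shift
  | there {Γ : Ctx} {n : ℕ} {A : Term} (B : Term) :
      InCtx Γ n A → InCtx (B :: Γ) (n + 1) A.shift

mutual

/-- Well-formed contexts of undirected CCω: `⊢ Γ`. -/
inductive WfCtx : Ctx → Prop
  | empty : WfCtx []
  | ext {Γ : Ctx} {A : Term} {i : ℕ} : WfCtx Γ → Typing Γ A (.sort i) → WfCtx (A :: Γ)

/-- Undirected typing of CCω: `Γ ⊢ t : T`. -/
inductive Typing : Ctx → Term → Term → Prop
  | sort {Γ : Ctx} (i : ℕ) : WfCtx Γ → Typing Γ (.sort i) (.sort (i + 1))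
  | var {Γ : Ctx} {n : ℕ} {A : Term} : WfCtx Γ → InCtx Γ n A → Typing Γ (.var n) A
  | prod {Γ : Ctx} {A B : Term} {i j : ℕ} :
      Typing Γ A (.sort i) → Typing (A :: Γ) B (.sort j) →
      Typing Γ (.prod A B) (.sort (max i j))
  | lam {Γ : Ctx} {A B t : Term} {i : ℕ} :
      Typing Γ (.prod A B) (.sort i) → Typing (A :: Γ) t B →
      Typing Γ (.lam A t) (.prod A B)
  | app {Γ : Ctx} {A B t u : Term} :
      Typing Γ t (.prod A B) → Typing Γ u A → Typing Γ (.app t u) (B.inst u)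
  | conv {Γ : Ctx} {A B t : Term} {i : ℕ} :
      Typing Γ t A → Typing Γ B (.sort i) → Conv A B → Typing Γ t B

end

/-- A type is well-formed in `Γ` if `Γ ⊢ T : □ i` for some `i`. -/
def WfType (Γ : Ctx) (T : Term) : Prop := ∃ i : ℕ, Typing Γ T (.sort i)

/-- The head constructors that constrained inference can impose on the inferred type. -/
inductive Head : Type
  | sort
  | prod

mutual

/-- Inference: `Γ ⊢ t ▹ T`. -/
inductive Infer : Ctx → Term → Term → Prop
  | sort (Γ : Ctx) (i : ℕ) : Infer Γ (.sort i) (.sort (i + 1))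
  | var {Γ : Ctx} {n : ℕ} {T : Term} : InCtx Γ n T → Infer Γ (.var n) T
  | prod {Γ : Ctx} {A B : Term} {i j : ℕ} :
      CInfer .sort Γ A (.sort i) → CInfer .sort (A :: Γ) B (.sort j) →
      Infer Γ (.prod A B) (.sort (max i j))
  | lam {Γ : Ctx} {A B t : Term} {i : ℕ} :
      CInfer .sort Γ A (.sort i) → Infer (A :: Γ) t B →
      Infer Γ (.lam A t) (.prod A B)
  | app {Γ : Ctx} {A B t u : Term} :
      CInfer .prod Γ t (.prod A B) → Check Γ u A → Infer Γ (.app t u) (B.inst u)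

/-- Checking: `Γ ⊢ t ◃ T`. -/
inductive Check : Ctx → Term → Term → Prop
  | check {Γ : Ctx} {t T T' : Term} : Infer Γ t T' → Conv T' T → Check Γ t T

/-- Constrained inference: `Γ ⊢ t ▹ₕ T`. -/
inductive CInfer : Head → Ctx → Term → Term → Prop
  | sort {Γ : Ctx} {t T : Term} {i : ℕ} :
      Infer Γ t T → Reds T (.sort i) → CInfer .sort Γ t (.sort i)
  | prod {Γ : Ctx} {t T A B : Term} :
      Infer Γ t T → Reds T (.prod A B) → CInfer .prod Γ t (.prod A B)

end

end CComega

/-!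
The three judgements are treated by a mutual induction on bidirectional derivations, in a
well-formed context. Undirected typing is recovered rule by rule, and two facts about it are needed
on the way. *Validity* (`Typing.wfType`): if `Γ ⊢ t : T` then `T` is well-formed; it supplies the
sort of the codomain in the rule for abstractions, and, with inversion of typed products, the
well-formedness of the domain against which the argument of an application is checked.
*Subject reduction* (`Typing.reds`): it shows that the product type to which an inferred type is
reduced in `▹_Π` is again well-formed, so that the conversion rule applies. For `▹_□` the latter
is not needed, because universes are well-formed in every well-formed context.

Validity rests on the stability of typing under well-typed renamings and substitutions
(`Typing.rename`, `Typing.subst`). The latter also gives, through the identity substitution, that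
the last declared type of a context may be replaced by a convertible one (`Typing.conv_head`).
The only delicate case of subject reduction is the β-rule, which needs that conversion is injective
on products (`Conv.prod_inj`); this follows from confluence, proved with parallel reduction `PRed`
and the complete development `Term.dev` of a term: every parallel reduct of `t` reduces in one
parallel step to `t.dev`.
-/

namespace CComega

/-! ### Renaming and substitution -/

theorem upRen_comp (ρ ρ' : ℕ → ℕ) : upRen ρ' ∘ upRen ρ = upRen (ρ' ∘ ρ) := by
  funext n; cases n <;> rfl

theorem Term.rename_rename (t : Term) (ρ ρ' : ℕ → ℕ) :
    (t.rename ρ).rename ρ' = t.rename (ρ' ∘ ρ) := by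
  induction t generalizing ρ ρ' <;> simp_all [Term.rename, upRen_comp]

theorem upSubst_comp_upRen (ρ : ℕ → ℕ) (σ : ℕ → Term) :
    upSubst σ ∘ upRen ρ = upSubst (σ ∘ ρ) := by
  funext n; cases n <;> rfl

theorem Term.subst_rename (t : Term) (ρ : ℕ → ℕ) (σ : ℕ → Term) :
    (t.rename ρ).subst σ = t.subst (σ ∘ ρ) := by
  induction t generalizing ρ σ <;> simp_all [Term.rename, Term.subst, upSubst_comp_upRen]

theorem Term.shift_rename (t : Term) (ρ : ℕ → ℕ) :
    t.shift.rename (upRen ρ) = (t.rename ρ).shift := by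
  simp only [Term.shift, Term.rename_rename]; rfl

theorem rename_comp_upSubst (σ : ℕ → Term) (ρ : ℕ → ℕ) :
    (fun n => (upSubst σ n).rename (upRen ρ)) = upSubst (fun n => (σ n).rename ρ) := by
  funext n
  cases n with
  | zero => rfl
  | succ n => exact Term.shift_rename _ _

theorem Term.rename_subst (t : Term) (σ : ℕ → Term) (ρ : ℕ → ℕ) :
    (t.subst σ).rename ρ = t.subst (fun n => (σ n).rename ρ) := by
  induction t generalizing ρ σ <;> simp_all [Term.rename, Term.subst, rename_comp_upSubst]

theorem Term.shift_subst (t : Term) (σ : ℕ → Term) :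
    t.shift.subst (upSubst σ) = (t.subst σ).shift := by
  simp only [Term.shift, Term.subst_rename, Term.rename_subst]; rfl

theorem subst_comp_upSubst (σ τ : ℕ → Term) :
    (fun n => (upSubst σ n).subst (upSubst τ)) = upSubst (fun n => (σ n).subst τ) := by
  funext n
  cases n with
  | zero => rfl
  | succ n => exact Term.shift_subst _ _

theorem Term.subst_subst (t : Term) (σ τ : ℕ → Term) :
    (t.subst σ).subst τ = t.subst (fun n => (σ n).subst τ) := by
  induction t generalizing σ τ <;> simp_all [Term.subst, subst_comp_upSubst]

theorem upSubst_var : upSubst Term.var = Term.var := by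
  funext n; cases n <;> rfl

theorem Term.subst_var (t : Term) : t.subst .var = t := by
  induction t <;> simp_all [Term.subst, upSubst_var]

theorem Term.shift_inst (t u : Term) : t.shift.inst u = t := by
  rw [Term.shift, Term.inst, Term.subst_rename]
  exact t.subst_var

theorem Term.inst_subst (t u : Term) (σ : ℕ → Term) :
    (t.inst u).subst σ = (t.subst (upSubst σ)).inst (u.subst σ) := by
  simp only [Term.inst, Term.subst_subst]
  congr 1
  funext n
  cases n with
  | zero => rfl
  | succ n => exact (Term.shift_inst _ _).symm

theorem Term.inst_rename (t u : Term) (ρ : ℕ → ℕ) :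
    (t.inst u).rename ρ = (t.rename (upRen ρ)).inst (u.rename ρ) := by
  simp only [Term.inst, Term.subst_rename, Term.rename_subst]
  congr 1
  funext n
  cases n <;> rfl

/-! ### Reduction and conversion -/

theorem Red.subst {t t' : Term} (h : Red t t') (σ : ℕ → Term) :
    Red (t.subst σ) (t'.subst σ) := by
  induction h generalizing σ with
  | beta T t u => rw [Term.inst_subst]; exact .beta _ _ _
  | prod_left B _ ih => exact .prod_left _ (ih _)
  | prod_right A _ ih => exact .prod_right _ (ih _)
  | lam_left t _ ih => exact .lam_left _ (ih _)
  | lam_right A _ ih => exact .lam_right _ (ih _)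
  | app_left u _ ih => exact .app_left _ (ih _)
  | app_right t _ ih => exact .app_right _ (ih _)

theorem Red.rename {t t' : Term} (h : Red t t') (ρ : ℕ → ℕ) :
    Red (t.rename ρ) (t'.rename ρ) := by
  induction h generalizing ρ with
  | beta T t u => rw [Term.inst_rename]; exact .beta _ _ _
  | prod_left B _ ih => exact .prod_left _ (ih _)
  | prod_right A _ ih => exact .prod_right _ (ih _)
  | lam_left t _ ih => exact .lam_left _ (ih _)
  | lam_right A _ ih => exact .lam_right _ (ih _)
  | app_left u _ ih => exact .app_left _ (ih _)
  | app_right t _ ih => exact .app_right _ (ih _)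

theorem Reds.map {f : Term → Term} (hf : ∀ {a b}, Red a b → Red (f a) (f b)) {t t' : Term}
    (h : Reds t t') : Reds (f t) (f t') :=
  Relation.ReflTransGen.lift f (fun _ _ => hf) _ _ h

theorem Conv.map {f : Term → Term} (hf : ∀ {a b}, Red a b → Red (f a) (f b)) {t t' : Term}
    (h : Conv t t') : Conv (f t) (f t') := by
  induction h with
  | rel _ _ h => exact .rel _ _ (hf h)
  | refl _ => exact .refl _
  | symm _ _ _ ih => exact .symm _ _ ih
  | trans _ _ _ _ _ ih₁ ih₂ => exact .trans _ _ _ ih₁ ih₂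

theorem Conv.symm {t t' : Term} (h : Conv t t') : Conv t' t := Relation.EqvGen.symm _ _ h

theorem Conv.trans {t u v : Term} (h : Conv t u) (h' : Conv u v) : Conv t v :=
  Relation.EqvGen.trans _ _ _ h h'

theorem Conv.subst {t t' : Term} (h : Conv t t') (σ : ℕ → Term) :
    Conv (t.subst σ) (t'.subst σ) :=
  h.map fun h => h.subst σ

theorem Conv.rename {t t' : Term} (h : Conv t t') (ρ : ℕ → ℕ) :
    Conv (t.rename ρ) (t'.rename ρ) :=
  h.map fun h => h.rename ρ

theorem Reds.conv {t t' : Term} (h : Reds t t') : Conv t t' := by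
  induction h with
  | refl => exact .refl _
  | tail _ h ih => exact ih.trans (.rel _ _ h)

theorem Reds.prod {A A' B B' : Term} (hA : Reds A A') (hB : Reds B B') :
    Reds (.prod A B) (.prod A' B') :=
  (hA.map (f := fun A => .prod A B) (.prod_left B)).trans
    (hB.map (f := fun B => .prod A' B) (.prod_right A'))

theorem Reds.lam {A A' t t' : Term} (hA : Reds A A') (ht : Reds t t') :
    Reds (.lam A t) (.lam A' t') :=
  (hA.map (f := fun A => .lam A t) (.lam_left t)).trans
    (ht.map (f := fun t => .lam A' t) (.lam_right A'))

theorem Reds.app {t t' u u' : Term} (ht : Reds t t') (hu : Reds u u') :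
    Reds (.app t u) (.app t' u') :=
  (ht.map (f := fun t => .app t u) (.app_left u)).trans
    (hu.map (f := fun u => .app t' u) (.app_right t'))

theorem Reds.upSubst {σ τ : ℕ → Term} (h : ∀ n, Reds (σ n) (τ n)) (n : ℕ) :
    Reds (upSubst σ n) (upSubst τ n) := by
  cases n with
  | zero => exact .refl
  | succ n => exact (h n).map fun h => h.rename _

theorem Reds.subst_congr (t : Term) {σ τ : ℕ → Term} (h : ∀ n, Reds (σ n) (τ n)) :
    Reds (t.subst σ) (t.subst τ) := by
  induction t generalizing σ τ with
  | var n => exact h n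
  | sort i => exact .refl
  | prod A B ihA ihB => exact (ihA h).prod (ihB (Reds.upSubst h))
  | lam A t ihA iht => exact (ihA h).lam (iht (Reds.upSubst h))
  | app t u iht ihu => exact (iht h).app (ihu h)

theorem Reds.inst_right (t : Term) {u u' : Term} (h : Reds u u') :
    Reds (t.inst u) (t.inst u') := by
  refine Reds.subst_congr t fun n => ?_
  cases n with
  | zero => exact h
  | succ n => exact .refl

/-! ### Parallel reduction and confluence -/

/-- Parallel reduction: any set of β-redexes already present in a term is contracted at once. -/
inductive PRed : Term → Term → Prop
  | var (n : ℕ) : PRed (.var n) (.var n)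
  | sort (i : ℕ) : PRed (.sort i) (.sort i)
  | prod {A A' B B' : Term} : PRed A A' → PRed B B' → PRed (.prod A B) (.prod A' B')
  | lam {A A' t t' : Term} : PRed A A' → PRed t t' → PRed (.lam A t) (.lam A' t')
  | app {t t' u u' : Term} : PRed t t' → PRed u u' → PRed (.app t u) (.app t' u')
  | beta (T : Term) {t t' u u' : Term} :
      PRed t t' → PRed u u' → PRed (.app (.lam T t) u) (t'.inst u')

/-- Complete development: all β-redexes already present in a term are contracted at once. -/
def Term.dev : Term → Term
  | .var n => .var n
  | .sort i => .sort i
  | .prod A B => .prod A.dev B.dev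
  | .lam A t => .lam A.dev t.dev
  | .app (.lam _ t) u => t.dev.inst u.dev
  | .app t u => .app t.dev u.dev

theorem PRed.refl (t : Term) : PRed t t := by
  induction t with
  | var n => exact .var n
  | sort i => exact .sort i
  | prod _ _ ih₁ ih₂ => exact .prod ih₁ ih₂
  | lam _ _ ih₁ ih₂ => exact .lam ih₁ ih₂
  | app _ _ ih₁ ih₂ => exact .app ih₁ ih₂

theorem PRed.of_red {t t' : Term} (h : Red t t') : PRed t t' := by
  induction h with
  | beta T t u => exact .beta T (.refl t) (.refl u)
  | prod_left B _ ih => exact .prod ih (.refl B)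
  | prod_right A _ ih => exact .prod (.refl A) ih
  | lam_left t _ ih => exact .lam ih (.refl t)
  | lam_right A _ ih => exact .lam (.refl A) ih
  | app_left u _ ih => exact .app ih (.refl u)
  | app_right t _ ih => exact .app (.refl t) ih

theorem PRed.reds {t t' : Term} (h : PRed t t') : Reds t t' := by
  induction h with
  | var n => exact .refl
  | sort i => exact .refl
  | prod _ _ ih₁ ih₂ => exact ih₁.prod ih₂
  | lam _ _ ih₁ ih₂ => exact ih₁.lam ih₂
  | app _ _ ih₁ ih₂ => exact ih₁.app ih₂
  | beta T _ _ ih₁ ih₂ =>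
    exact Relation.ReflTransGen.tail (Reds.app (Reds.lam .refl ih₁) ih₂) (.beta T _ _)

theorem PRed.rename {t t' : Term} (h : PRed t t') (ρ : ℕ → ℕ) :
    PRed (t.rename ρ) (t'.rename ρ) := by
  induction h generalizing ρ with
  | var n => exact .var _
  | sort i => exact .sort i
  | prod _ _ ih₁ ih₂ => exact .prod (ih₁ _) (ih₂ _)
  | lam _ _ ih₁ ih₂ => exact .lam (ih₁ _) (ih₂ _)
  | app _ _ ih₁ ih₂ => exact .app (ih₁ _) (ih₂ _)
  | beta T _ _ ih₁ ih₂ => rw [Term.inst_rename]; exact .beta _ (ih₁ _) (ih₂ _)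

theorem PRed.upSubst {σ τ : ℕ → Term} (h : ∀ n, PRed (σ n) (τ n)) (n : ℕ) :
    PRed (upSubst σ n) (upSubst τ n) := by
  cases n with
  | zero => exact .var 0
  | succ n => exact (h n).rename _

theorem PRed.subst {t t' : Term} (h : PRed t t') {σ τ : ℕ → Term}
    (hσ : ∀ n, PRed (σ n) (τ n)) : PRed (t.subst σ) (t'.subst τ) := by
  induction h generalizing σ τ with
  | var n => exact hσ n
  | sort i => exact .sort i
  | prod _ _ ih₁ ih₂ => exact .prod (ih₁ hσ) (ih₂ (PRed.upSubst hσ))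
  | lam _ _ ih₁ ih₂ => exact .lam (ih₁ hσ) (ih₂ (PRed.upSubst hσ))
  | app _ _ ih₁ ih₂ => exact .app (ih₁ hσ) (ih₂ hσ)
  | beta T _ _ ih₁ ih₂ =>
    rw [Term.inst_subst]; exact .beta _ (ih₁ (PRed.upSubst hσ)) (ih₂ hσ)

theorem PRed.inst {t t' u u' : Term} (ht : PRed t t') (hu : PRed u u') :
    PRed (t.inst u) (t'.inst u') := by
  refine ht.subst fun n => ?_
  cases n with
  | zero => exact hu
  | succ n => exact .var n

/-- The triangle property of parallel reduction, from which its diamond property is immediate. -/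
theorem PRed.dev {t t' : Term} (h : PRed t t') : PRed t' t.dev := by
  induction h with
  | var n => exact .var n
  | sort i => exact .sort i
  | prod _ _ ih₁ ih₂ => exact .prod ih₁ ih₂
  | lam _ _ ih₁ ih₂ => exact .lam ih₁ ih₂
  | beta T _ _ ih₁ ih₂ => exact ih₁.inst ih₂
  | @app t t' u u' h₁ _ ih₁ ih₂ =>
    cases t with
    | lam T s =>
      cases h₁ with
      | lam _ _ =>
        cases ih₁ with
        | lam _ ihs => exact .beta _ ihs ih₂
    | var _ => exact .app ih₁ ih₂
    | sort _ => exact .app ih₁ ih₂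
    | prod _ _ => exact .app ih₁ ih₂
    | app _ _ => exact .app ih₁ ih₂

theorem Reds.pReds {t t' : Term} (h : Reds t t') : Relation.ReflTransGen PRed t t' :=
  Relation.ReflTransGen.mono (fun _ _ => PRed.of_red) _ _ h

theorem reds_of_pReds {t t' : Term} (h : Relation.ReflTransGen PRed t t') : Reds t t' := by
  induction h with
  | refl => exact .refl
  | tail _ h ih => exact Relation.ReflTransGen.trans ih h.reds

theorem Reds.confluent {t u v : Term} (hu : Reds t u) (hv : Reds t v) :
    ∃ w, Reds u w ∧ Reds v w := by
  obtain ⟨w, huw, hvw⟩ := Relation.church_rosser (r := PRed)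
    (fun a b c hb hc => ⟨a.dev, .single (PRed.dev hb), .single (PRed.dev hc)⟩) hu.pReds hv.pReds
  exact ⟨w, reds_of_pReds huw, reds_of_pReds hvw⟩

theorem Conv.exists_common_reduct {t u : Term} (h : Conv t u) : ∃ w, Reds t w ∧ Reds u w := by
  induction h with
  | rel _ _ h => exact ⟨_, .single h, .refl⟩
  | refl _ => exact ⟨_, .refl, .refl⟩
  | symm _ _ _ ih => obtain ⟨w, h₁, h₂⟩ := ih; exact ⟨w, h₂, h₁⟩
  | trans _ _ _ _ _ ih₁ ih₂ =>
    obtain ⟨w₁, h₁, h₁'⟩ := ih₁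
    obtain ⟨w₂, h₂, h₂'⟩ := ih₂
    obtain ⟨w, hw₁, hw₂⟩ := h₁'.confluent h₂
    exact ⟨w, h₁.trans hw₁, h₂'.trans hw₂⟩

theorem Reds.prod_inv {A B T : Term} (h : Reds (.prod A B) T) :
    ∃ A' B', T = .prod A' B' ∧ Reds A A' ∧ Reds B B' := by
  induction h with
  | refl => exact ⟨A, B, rfl, .refl, .refl⟩
  | tail _ h ih =>
    obtain ⟨A', B', rfl, hA, hB⟩ := ih
    cases h with
    | prod_left _ h => exact ⟨_, _, rfl, hA.tail h, hB⟩
    | prod_right _ h => exact ⟨_, _, rfl, hA, hB.tail h⟩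

theorem Conv.prod_inj {A A' B B' : Term} (h : Conv (.prod A B) (.prod A' B')) :
    Conv A A' ∧ Conv B B' := by
  obtain ⟨w, h₁, h₂⟩ := h.exists_common_reduct
  obtain ⟨A₁, B₁, rfl, hA₁, hB₁⟩ := h₁.prod_inv
  obtain ⟨A₂, B₂, he, hA₂, hB₂⟩ := h₂.prod_inv
  cases he
  exact ⟨hA₁.conv.trans hA₂.conv.symm, hB₁.conv.trans hB₂.conv.symm⟩

/-! ### Renaming and substitution in typing derivations -/

/-- Induction on typing derivations alone: the context judgements occurring in them are plain
hypotheses. -/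
theorem Typing.induct {P : ∀ {Γ : Ctx} {t T : Term}, Typing Γ t T → Prop}
    (sort : ∀ {Γ : Ctx} (i : ℕ) (hΓ : WfCtx Γ), P (.sort i hΓ))
    (var : ∀ {Γ : Ctx} {n : ℕ} {A : Term} (hΓ : WfCtx Γ) (hn : InCtx Γ n A), P (.var hΓ hn))
    (prod : ∀ {Γ : Ctx} {A B : Term} {i j : ℕ} (hA : Typing Γ A (.sort i))
      (hB : Typing (A :: Γ) B (.sort j)), P hA → P hB → P (.prod hA hB))
    (lam : ∀ {Γ : Ctx} {A B t : Term} {i : ℕ} (hP : Typing Γ (.prod A B) (.sort i))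
      (ht : Typing (A :: Γ) t B), P hP → P ht → P (.lam hP ht))
    (app : ∀ {Γ : Ctx} {A B t u : Term} (ht : Typing Γ t (.prod A B)) (hu : Typing Γ u A),
      P ht → P hu → P (.app ht hu))
    (conv : ∀ {Γ : Ctx} {A B t : Term} {i : ℕ} (ht : Typing Γ t A)
      (hB : Typing Γ B (.sort i)) (hc : Conv A B), P ht → P hB → P (.conv ht hB hc))
    {Γ : Ctx} {t T : Term} (h : Typing Γ t T) : P h :=
  Typing.rec (motive_1 := fun _ _ => True) (motive_2 := fun _ _ _ h => P h)
    trivial (fun _ _ _ _ => trivial) (fun i h _ => sort i h) (fun h h' _ => var h h')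
    prod lam app conv h

theorem Typing.wfCtx {Γ : Ctx} {t T : Term} (h : Typing Γ t T) : WfCtx Γ := by
  induction h using Typing.induct with
  | sort _ h => exact h
  | var h _ => exact h
  | prod _ _ ih _ => exact ih
  | lam _ _ ih _ => exact ih
  | app _ _ ih _ => exact ih
  | conv _ _ _ ih _ => exact ih

theorem Typing.prod_inv {Γ : Ctx} {A B T : Term} (h : Typing Γ (.prod A B) T) :
    WfType Γ A ∧ WfType (A :: Γ) B := by
  generalize ht : Term.prod A B = t at h
  induction h using Typing.induct with
  | prod hA hB _ _ => cases ht; exact ⟨⟨_, hA⟩, ⟨_, hB⟩⟩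
  | conv _ _ _ ih _ => exact ih ht
  | _ => cases ht

theorem Typing.lam_inv {Γ : Ctx} {A t T : Term} (h : Typing Γ (.lam A t) T) :
    ∃ B, WfType Γ (.prod A B) ∧ Typing (A :: Γ) t B ∧ Conv (.prod A B) T := by
  generalize ht : Term.lam A t = s at h
  induction h using Typing.induct with
  | lam hP hB _ _ => cases ht; exact ⟨_, ⟨_, hP⟩, hB, .refl _⟩
  | conv _ _ hc ih _ =>
    obtain ⟨B, h₁, h₂, h₃⟩ := ih ht
    exact ⟨B, h₁, h₂, h₃.trans hc⟩
  | _ => cases ht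

/-- `ρ` sends each variable declared in `Γ` to a variable of `Δ` with the renamed type. -/
def WfRen (Δ Γ : Ctx) (ρ : ℕ → ℕ) : Prop :=
  ∀ n A, InCtx Γ n A → InCtx Δ (ρ n) (A.rename ρ)

theorem WfRen.up {Δ Γ : Ctx} {ρ : ℕ → ℕ} (h : WfRen Δ Γ ρ) (A : Term) :
    WfRen (A.rename ρ :: Δ) (A :: Γ) (upRen ρ) := by
  intro n T hT
  cases hT with
  | here => rw [Term.shift_rename]; exact .here _ _
  | there _ hT => rw [Term.shift_rename]; exact .there _ (h _ _ hT)

theorem Typing.rename {Γ : Ctx} {t T : Term} (h : Typing Γ t T) :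
    ∀ {Δ : Ctx} {ρ : ℕ → ℕ}, WfCtx Δ → WfRen Δ Γ ρ → Typing Δ (t.rename ρ) (T.rename ρ) := by
  induction h using Typing.induct with
  | sort i _ => intro Δ ρ hΔ _; exact .sort i hΔ
  | var _ hn => intro Δ ρ hΔ hρ; exact .var hΔ (hρ _ _ hn)
  | @prod Γ A B i j _ _ ihA ihB =>
    intro Δ ρ hΔ hρ
    exact .prod (ihA hΔ hρ) (ihB (.ext hΔ (ihA hΔ hρ)) (hρ.up A))
  | @lam Γ A B t i _ _ ihP iht =>
    intro Δ ρ hΔ hρ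
    obtain ⟨⟨_, hA⟩, -⟩ := (ihP hΔ hρ).prod_inv
    exact .lam (ihP hΔ hρ) (iht (.ext hΔ hA) (hρ.up A))
  | app _ _ iht ihu =>
    intro Δ ρ hΔ hρ
    rw [Term.inst_rename]
    exact .app (iht hΔ hρ) (ihu hΔ hρ)
  | conv _ _ hc iht ihB =>
    intro Δ ρ hΔ hρ
    exact .conv (iht hΔ hρ) (ihB hΔ hρ) (hc.rename ρ)

theorem Typing.weaken {Γ : Ctx} {A t T : Term} (h : Typing Γ t T) (hA : WfType Γ A) :
    Typing (A :: Γ) t.shift T.shift := by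
  obtain ⟨i, hA⟩ := hA
  exact h.rename (.ext h.wfCtx hA) fun n T hT => .there A hT

/-- `σ` sends each variable declared in `Γ` to a term of the substituted type in `Δ`. -/
def WfSubst (Δ Γ : Ctx) (σ : ℕ → Term) : Prop :=
  ∀ n A, InCtx Γ n A → Typing Δ (σ n) (A.subst σ)

theorem WfSubst.up {Δ Γ : Ctx} {σ : ℕ → Term} (h : WfSubst Δ Γ σ) {A : Term} (hΔ : WfCtx Δ)
    (hA : WfType Δ (A.subst σ)) : WfSubst (A.subst σ :: Δ) (A :: Γ) (upSubst σ) := by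
  intro n T hT
  cases hT with
  | here =>
    obtain ⟨i, hA⟩ := hA
    rw [Term.shift_subst]
    exact .var (.ext hΔ hA) (.here _ _)
  | there _ hT => rw [Term.shift_subst]; exact (h _ _ hT).weaken hA

theorem Typing.subst {Γ : Ctx} {t T : Term} (h : Typing Γ t T) :
    ∀ {Δ : Ctx} {σ : ℕ → Term}, WfCtx Δ → WfSubst Δ Γ σ → Typing Δ (t.subst σ) (T.subst σ) := by
  induction h using Typing.induct with
  | sort i _ => intro Δ σ hΔ _; exact .sort i hΔ
  | var _ hn => intro Δ σ hΔ hσ; exact hσ _ _ hn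
  | prod _ _ ihA ihB =>
    intro Δ σ hΔ hσ
    have hA := ihA hΔ hσ
    exact .prod hA (ihB (.ext hΔ hA) (hσ.up hΔ ⟨_, hA⟩))
  | lam _ _ ihP iht =>
    intro Δ σ hΔ hσ
    obtain ⟨⟨_, hA⟩, -⟩ := (ihP hΔ hσ).prod_inv
    exact .lam (ihP hΔ hσ) (iht (.ext hΔ hA) (hσ.up hΔ ⟨_, hA⟩))
  | app _ _ iht ihu =>
    intro Δ σ hΔ hσ
    rw [Term.inst_subst]
    exact .app (iht hΔ hσ) (ihu hΔ hσ)
  | conv _ _ hc iht ihB =>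
    intro Δ σ hΔ hσ
    exact .conv (iht hΔ hσ) (ihB hΔ hσ) (hc.subst σ)

theorem Typing.inst {Γ : Ctx} {A t T u : Term} (h : Typing (A :: Γ) t T) (hu : Typing Γ u A) :
    Typing Γ (t.inst u) (T.inst u) := by
  refine h.subst hu.wfCtx fun n B hB => ?_
  cases hB with
  | here =>
    change Typing Γ u (A.shift.inst u)
    rwa [Term.shift_inst]
  | @there _ n B _ hB =>
    change Typing Γ (.var n) (B.shift.inst u)
    rw [Term.shift_inst]
    exact .var hu.wfCtx hB

/-! ### Validity and subject reduction -/

theorem InCtx.wfType {Γ : Ctx} {n : ℕ} {A : Term} (h : InCtx Γ n A) (hΓ : WfCtx Γ) :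
    WfType Γ A := by
  induction h with
  | here Γ A =>
    cases hΓ with
    | ext _ hA => exact ⟨_, hA.weaken ⟨_, hA⟩⟩
  | there B _ ih =>
    cases hΓ with
    | ext hΓ hB =>
      obtain ⟨i, hA⟩ := ih hΓ
      exact ⟨i, hA.weaken ⟨_, hB⟩⟩

/-- Validity: a type that is inhabited is well-formed. -/
theorem Typing.wfType {Γ : Ctx} {t T : Term} (h : Typing Γ t T) : WfType Γ T := by
  induction h using Typing.induct with
  | sort i hΓ => exact ⟨_, .sort _ hΓ⟩
  | var hΓ hn => exact hn.wfType hΓ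
  | prod hA _ _ _ => exact ⟨_, .sort _ hA.wfCtx⟩
  | lam hP _ _ _ => exact ⟨_, hP⟩
  | app _ hu ih _ =>
    obtain ⟨_, hP⟩ := ih
    obtain ⟨-, j, hB⟩ := hP.prod_inv
    exact ⟨j, hB.inst hu⟩
  | conv _ hB _ _ _ => exact ⟨_, hB⟩

/-- The last declared type of a context may be replaced by a convertible one. -/
theorem Typing.conv_head {Γ : Ctx} {A A' t T : Term} (h : Typing (A :: Γ) t T)
    (hA : WfType Γ A) (hA' : WfType Γ A') (hc : Conv A' A) : Typing (A' :: Γ) t T := by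
  obtain ⟨i, hA⟩ := hA
  obtain ⟨i', hA'⟩ := hA'
  have hΓ : WfCtx (A' :: Γ) := .ext hA'.wfCtx hA'
  have hid : WfSubst (A' :: Γ) (A :: Γ) .var := by
    intro n B hB
    rw [Term.subst_var]
    cases hB with
    | here =>
      exact .conv (.var hΓ (.here _ _)) (hA.weaken ⟨_, hA'⟩) (hc.rename _)
    | there _ hB => exact .var hΓ (.there _ hB)
  simpa only [Term.subst_var] using h.subst hΓ hid

theorem Typing.red {Γ : Ctx} {t T : Term} (h : Typing Γ t T) :
    ∀ {t' : Term}, Red t t' → Typing Γ t' T := by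
  induction h using Typing.induct with
  | sort i _ => intro t' hr; cases hr
  | var _ _ => intro t' hr; cases hr
  | prod hA hB ihA ihB =>
    intro t' hr
    cases hr with
    | prod_left _ hr =>
      exact .prod (ihA hr) (hB.conv_head ⟨_, hA⟩ ⟨_, ihA hr⟩ (Conv.symm (.rel _ _ hr)))
    | prod_right _ hr => exact .prod hA (ihB hr)
  | lam hP ht ihP iht =>
    intro t' hr
    cases hr with
    | lam_left _ hr =>
      -- The reduct is an abstraction over the reduced domain, so its type is converted back.
      have hP' := ihP (.prod_left _ hr)
      have ht' := ht.conv_head hP.prod_inv.1 hP'.prod_inv.1 (Conv.symm (.rel _ _ hr))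
      exact .conv (.lam hP' ht') hP (Conv.symm (.rel _ _ (.prod_left _ hr)))
    | lam_right _ hr => exact .lam hP (iht hr)
  | @app Γ A B t u ht hu iht ihu =>
    intro t' hr
    obtain ⟨_, hBu⟩ := (Typing.app ht hu).wfType
    cases hr with
    | beta T s =>
      -- Inversion types the abstraction at some `Π T B'` merely convertible to `Π A B`; injectivity
      -- lets `u` be used at type `T` and brings the result back from `B'[u]` to `B[u]`.
      obtain ⟨B', ⟨_, hP⟩, hs, hc⟩ := ht.lam_inv
      obtain ⟨⟨_, hT⟩, -⟩ := hP.prod_inv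
      obtain ⟨hcA, hcB⟩ := hc.prod_inj
      exact .conv (hs.inst (.conv hu hT hcA.symm)) hBu (hcB.subst _)
    | app_left _ hr => exact .app (iht hr) hu
    | app_right _ hr =>
      exact .conv (.app ht (ihu hr)) hBu (Reds.inst_right B (.single hr)).conv.symm
  | conv _ hB hc iht _ => intro t' hr; exact .conv (iht hr) hB hc

theorem Typing.reds {Γ : Ctx} {t t' T : Term} (h : Typing Γ t T) (hr : Reds t t') :
    Typing Γ t' T := by
  induction hr with
  | refl => exact h
  | tail _ hr ih => exact ih.red hr

/-! ### Soundness of bidirectional typing -/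

mutual

theorem Infer.typing {Γ : Ctx} {t T : Term} (hΓ : WfCtx Γ) : Infer Γ t T → Typing Γ t T
  | .sort _ i => .sort i hΓ
  | .var hn => .var hΓ hn
  | .prod hA hB =>
    have hA' := hA.typing hΓ
    .prod hA' (hB.typing (.ext hΓ hA'))
  | .lam hA ht =>
    have hA' := hA.typing hΓ
    have ht' := ht.typing (.ext hΓ hA')
    have ⟨_, hB⟩ := ht'.wfType
    .lam (.prod hA' hB) ht'
  | .app ht hu =>
    have ht' := ht.typing hΓ
    have ⟨_, hP⟩ := ht'.wfType
    .app ht' (hu.typing hΓ hP.prod_inv.1)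

theorem Check.typing {Γ : Ctx} {t T : Term} (hΓ : WfCtx Γ) (hT : WfType Γ T) :
    Check Γ t T → Typing Γ t T
  | .check ht hc =>
    have ⟨_, hT⟩ := hT
    .conv (ht.typing hΓ) hT hc

theorem CInfer.typing {h : Head} {Γ : Ctx} {t T : Term} (hΓ : WfCtx Γ) :
    CInfer h Γ t T → Typing Γ t T
  | .sort ht hr => .conv (ht.typing hΓ) (.sort _ hΓ) hr.conv
  | .prod ht hr =>
    have ht' := ht.typing hΓ
    have ⟨_, hT⟩ := ht'.wfType
    .conv ht' (hT.reds hr) hr.conv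

end

end CComega

theorem mainTheorem2 :
    (∀ (Γ : CComega.Ctx) (t T : CComega.Term), CComega.WfCtx Γ →
      (CComega.Infer Γ t T ∨ ∃ h : CComega.Head, CComega.CInfer h Γ t T) →
      CComega.Typing Γ t T) ∧
    (∀ (Γ : CComega.Ctx) (t T : CComega.Term), CComega.WfCtx Γ → CComega.WfType Γ T →
      CComega.Check Γ t T → CComega.Typing Γ t T) := by
  refine ⟨fun Γ t T hΓ h => ?_, fun Γ t T hΓ hT h => h.typing hΓ hT⟩
  rcases h with h | ⟨_, h⟩
  · exact h.typing hΓ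
  · exact h.typing hΓ
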